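/- Let $G$ be a finite group with identity $e$, and let $H$ be a Frobenius complement in $G$, i.e. a proper, non-trivial subgroup of $G$ with $H\cap gHg^{-1}=\{e\}$ for all $g\in G\setminus H$. Let $K=\bigl(G\setminus\bigcup_{g\in G}gHg^{-1}\bigr)\cup\{e\}$ be the corresponding Frobenius kernel (so that $G=K\rtimes H$). Suppose that $H$ is abelian of order $h$ and that $K$ is abelian of order $k$. Then $h$ divides $k-1$. Moreover: 1. $G$ has trivial centre; it has exactly $(k-1)/h$ conjugacy classes of size $h$ and exactly $h-1$ conjugacy classes of size $k$; and every conjugacy class other than $\{e\}$ has size $h$ or $k$. 2. Exactly $h$ of the irreducible complex characters of $G$ are linear (that is, are homomorphisms from $G$ to the unit circle), and every other irreducible complex character of $G$ has degree $h$, where the degree of a character $\chi$ is $\chi(e)$. -/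

import Mathlib

/-- `H` is a Frobenius complement in `G`: a proper, non-trivial subgroup which is malnormal, that is
`H ∩ gHg⁻¹ = {e}` for every `g ∈ G \ H`. (The finiteness of `G` is assumed separately.) -/
structure IsFrobeniusComplement {G : Type*} [Group G] (H : Subgroup G) : Prop where
  proper : H ≠ ⊤
  nontrivial : H ≠ ⊥
  malnormal : ∀ g : G, g ∉ H → H ⊓ H.map (MulAut.conj g).toMonoidHom = ⊥

/-- The Frobenius kernel `K = (G \ ⋃ g, gHg⁻¹) ∪ {e}`, as a subset of `G`. -/
def frobeniusKernel {G : Type*} [Group G] (H : Subgroup G) : Set G :=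
  (⋃ g : G, (H.map (MulAut.conj g).toMonoidHom : Set G))ᶜ ∪ {1}

/-- `Irr(G)`: the set of characters of irreducible finite-dimensional complex representations. Up to
isomorphism such a representation lives on `ℂⁿ` for some `n`. -/
def irrCharacters (G : Type*) [Group G] : Set (G → ℂ) :=
  {χ | ∃ (n : ℕ) (ρ : Representation ℂ G (Fin n → ℂ)), ρ.IsIrreducible ∧ ρ.character = χ}

/-- A character is linear if it is a homomorphism from `G` to the unit circle. -/
def IsLinearChar {G : Type*} [Group G] (χ : G → ℂ) : Prop :=
  ∃ φ : G →* Circle, ∀ g : G, χ g = (φ g : ℂ)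

/-!
Malnormality gives `C_G(y) = H` for `1 ≠ y ∈ H` and `C_G(x) = K` for `1 ≠ x ∈ K`. As the
conjugates of `H` cover everything outside `K`, every nontrivial class has size `h` or `k`,
according as it lies in `K` or not, and counting elements of each kind counts the classes.

The same facts make `K` an abelian normal complement on which every `1 ≠ y ∈ H` acts without
nontrivial fixed points, so that `x ↦ [x, y]` permutes `K` and `[G, G] = K`; hence there are
`|G / K| = h` linear characters. An irreducible representation restricted to `K` has a weight
vector `v`, of weight `μ` say. If `μ = 1`, then `K` acts trivially and the representation factors
through the abelian group `G / K`. Otherwise, since the commutators `[x, y]` exhaust `K`, the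
`H`-conjugates of `μ` are distinct, and the vectors `y • v` for `y ∈ H` form a basis.
-/

section Weights

variable {k G V : Type*} [Field k] [AddCommGroup V] [Module k V]

/-- `v` is a weight vector of weight `μ` for `ρ`: a common eigenvector of the operators `ρ g`, whose
eigenvalues form the linear character `μ`. -/
structure IsWeightVector [Monoid G] (ρ : Representation k G V) (μ : G →* k) (v : V) : Prop where
  ne_zero : v ≠ 0
  apply_eq_smul : ∀ g, ρ g v = μ g • v

theorem exists_monoidHom_smul_of_finrank_eq_one [Monoid G] (hV : Module.finrank k V = 1)
    (ρ : Representation k G V) : ∃ μ : G →* k, ∀ g, ρ g = algebraMap k (Module.End k V) (μ g) := by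
  have := Module.finite_of_finrank_eq_succ hV
  have hEnd : Module.finrank k (Module.End k V) = 1 := by rw [Module.finrank_linearMap, hV]
  let e := AlgEquiv.ofBijective (Algebra.ofId k (Module.End k V))
    (Algebra.finrank_eq_one_iff_bijective_algebraMap.1 hEnd)
  exact ⟨(e.symm : Module.End k V →* k).comp ρ, fun g ↦ (e.apply_symm_apply (ρ g)).symm⟩

theorem exists_isWeightVector [Monoid G] [IsAlgClosed k] [FiniteDimensional k V] [Nontrivial V]
    (ρ : Representation k G V) (hρ : ∀ g g', Commute (ρ g) (ρ g')) :
    ∃ μ v, IsWeightVector ρ μ v := by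
  let A := Algebra.adjoin k (Set.range ρ)
  have : IsMulCommutative A := Algebra.isMulCommutative_adjoin k (by
    rintro _ ⟨g, rfl⟩ _ ⟨g', rfl⟩
    exact hρ g g')
  have : IsArtinian A V := isArtinian_of_tower k inferInstance
  obtain ⟨S, hS⟩ := IsAtomic.exists_atom (Submodule A V)
  have : IsSimpleModule A S := isSimpleModule_iff_isAtom.2 hS
  let σ := ρ.subrepresentation (S.restrictScalars k) fun g v hv ↦
    S.smul_mem ⟨ρ g, Algebra.subset_adjoin ⟨g, rfl⟩⟩ hv
  have : FiniteDimensional k S := inferInstanceAs (FiniteDimensional k (S.restrictScalars k))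
  have hS_line : Module.finrank k S = 1 := IsSimpleModule.finrank_eq_one_of_isMulCommutative A S k
  obtain ⟨μ, hμ⟩ := exists_monoidHom_smul_of_finrank_eq_one hS_line σ
  have := IsSimpleModule.nontrivial A S
  obtain ⟨v, hv⟩ := exists_ne (0 : S)
  exact ⟨μ, v, by simpa using hv, fun g ↦ congrArg Subtype.val (LinearMap.congr_fun (hμ g) v)⟩

namespace IsWeightVector

-- Applying linear functionals reduces this to Dedekind's independence of characters.
theorem linearIndependent [Monoid G] {ι : Type*} {ρ : Representation k G V} {μ : ι → G →* k}
    {v : ι → V} (hv : ∀ i, IsWeightVector ρ (μ i) (v i)) (hμ : Function.Injective μ) :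
    LinearIndependent k v := by
  rw [linearIndependent_iff']
  intro s c hsum i hi
  have coord_eq_zero (f : Module.Dual k V) : c i * f (v i) = 0 := by
    refine linearIndependent_iff'.1 ((linearIndependent_monoidHom G k).comp μ hμ) s
      (fun j ↦ c j * f (v j)) (funext fun g ↦ ?_) i hi
    have := congrArg (fun w ↦ f (ρ g w)) hsum
    simpa [(hv _).apply_eq_smul, mul_assoc, mul_comm, mul_left_comm] using this
  have := (Module.forall_dual_apply_eq_zero_iff k (c i • v i)).1 fun f ↦ by
    rw [map_smul, smul_eq_mul, coord_eq_zero]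
  exact (smul_eq_zero.1 this).resolve_right (hv i).ne_zero

theorem conj [Group G] {N : Subgroup G} [N.Normal] {ρ : Representation k G V} {μ : N →* k} {v : V}
    (hv : IsWeightVector (ρ.comp N.subtype) μ v) (g : G) :
    IsWeightVector (ρ.comp N.subtype) (μ.comp (MulAut.conjNormal g⁻¹ : N ≃* N).toMonoidHom)
      (ρ g v) where
  ne_zero := (map_ne_zero_iff _ (ρ.apply_bijective g).injective).2 hv.ne_zero
  apply_eq_smul x := by
    have hx : (x : G) * g = g * (MulAut.conjNormal g⁻¹ x : N) := by
      rw [MulAut.conjNormal_apply]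
      group
    calc ρ x (ρ g v) = ρ g (ρ (MulAut.conjNormal g⁻¹ x : N) v) := by
          rw [← Module.End.mul_apply, ← map_mul, hx, map_mul, Module.End.mul_apply]
      _ = _ := by
          have := hv.apply_eq_smul (MulAut.conjNormal g⁻¹ x)
          rw [MonoidHom.comp_apply, Subgroup.subtype_apply] at this
          rw [this, map_smul]
          rfl

end IsWeightVector

end Weights

section IrreducibleRepresentations

variable {k G V : Type*} [Field k] [AddCommGroup V] [Module k V]

theorem isIrreducible_of_finrank_eq_one [Monoid G] (hV : Module.finrank k V = 1)
    (ρ : Representation k G V) : ρ.IsIrreducible where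
  exists_pair_ne := by
    have := Module.nontrivial_of_finrank_eq_succ hV
    exact ⟨⊥, ⊤, fun h ↦ bot_ne_top (congrArg Subrepresentation.toSubmodule h)⟩
  eq_bot_or_eq_top W := by
    have := isSimpleModule_iff_finrank_eq_one.2 hV
    exact (eq_bot_or_eq_top W.toSubmodule).imp
      (fun h ↦ Subrepresentation.toSubmodule_injective h)
      (fun h ↦ Subrepresentation.toSubmodule_injective h)

theorem nontrivial_of_isIrreducible [Monoid G] (ρ : Representation k G V) [ρ.IsIrreducible] :
    Nontrivial V :=
  ρ.asModuleEquiv.symm.toEquiv.nontrivial_congr.2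
    (IsSimpleModule.nontrivial (MonoidAlgebra k G) ρ.asModule)

theorem eq_top_of_isIrreducible_of_le_comap [Monoid G] (ρ : Representation k G V) [ρ.IsIrreducible]
    {W : Submodule k V} (hW : ∀ g, W ≤ W.comap (ρ g)) {v : V} (hv : v ∈ W) (hv0 : v ≠ 0) :
    W = ⊤ := by
  refine (eq_bot_or_eq_top (⟨W, fun g v hv ↦ hW g hv⟩ : Subrepresentation ρ)).elim
    (fun h ↦ absurd ?_ hv0) (congrArg Subrepresentation.toSubmodule)
  have hbot : W = ⊥ := congrArg Subrepresentation.toSubmodule h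
  simpa [hbot] using hv

theorem finrank_eq_one_of_commutator_le_ker [Group G] [IsAlgClosed k] [FiniteDimensional k V]
    (ρ : Representation k G V) [ρ.IsIrreducible] (hρ : commutator G ≤ ρ.ker) :
    Module.finrank k V = 1 := by
  have hcomm (g g' : G) : Commute (ρ g) (ρ g') := by
    have := hρ (Subgroup.commutator_mem_commutator (Subgroup.mem_top g) (Subgroup.mem_top g'))
    rw [MonoidHom.mem_ker, commutatorElement_def] at this
    calc ρ g * ρ g' = ρ (g * g' * g⁻¹ * g'⁻¹) * ρ (g' * g) := by
          rw [← map_mul, ← map_mul]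
          group
      _ = ρ g' * ρ g := by rw [this, one_mul, map_mul]
  have := nontrivial_of_isIrreducible ρ
  obtain ⟨μ, v, hv⟩ := exists_isWeightVector ρ hcomm
  have hspan : Submodule.span k {v} = ⊤ := by
    refine eq_top_of_isIrreducible_of_le_comap ρ (fun g ↦ ?_)
      (Submodule.mem_span_singleton_self v) hv.ne_zero
    rw [Submodule.span_singleton_le_iff_mem, Submodule.mem_comap, hv.apply_eq_smul]
    exact Submodule.smul_mem _ _ (Submodule.mem_span_singleton_self v)
  rw [← finrank_top, ← hspan, finrank_span_singleton hv.ne_zero]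

variable [Group G] {N : Subgroup G} [N.Normal]

theorem le_ker_of_isWeightVector_one (ρ : Representation k G V) [ρ.IsIrreducible] {v : V}
    (hv : IsWeightVector (ρ.comp N.subtype) 1 v) : N ≤ ρ.ker := by
  have hinv : Representation.invariants (ρ.comp N.subtype) = ⊤ :=
    eq_top_of_isIrreducible_of_le_comap ρ (ρ.le_comap_invariants N)
      (fun x ↦ (hv.apply_eq_smul x).trans (one_smul k v)) hv.ne_zero
  intro x hx
  ext w
  have hw : w ∈ Representation.invariants (ρ.comp N.subtype) := hinv ▸ Submodule.mem_top
  exact hw ⟨x, hx⟩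

theorem finrank_eq_card_of_injective_conj_weight {H : Subgroup G} [Finite H] (hHN : H ⊔ N = ⊤)
    (ρ : Representation k G V) [ρ.IsIrreducible] {μ : N →* k} {v : V}
    (hv : IsWeightVector (ρ.comp N.subtype) μ v)
    (hμ : Function.Injective fun y : H ↦
      μ.comp (MulAut.conjNormal (y : G)⁻¹ : N ≃* N).toMonoidHom) :
    Module.finrank k V = Nat.card H := by
  have := Fintype.ofFinite H
  have hlin : LinearIndependent k fun y : H ↦ ρ y v :=
    IsWeightVector.linearIndependent (fun y : H ↦ hv.conj y) hμ
  have hspan : Submodule.span k (Set.range fun y : H ↦ ρ y v) = ⊤ := by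
    refine eq_top_of_isIrreducible_of_le_comap ρ (fun g ↦ ?_)
      (Submodule.subset_span ⟨1, by simp⟩) hv.ne_zero
    rw [Submodule.span_le, Set.range_subset_iff]
    intro y
    obtain ⟨z, hz, x, hx, rfl⟩ :=
      Subgroup.mem_sup_of_normal_right.1 (hHN ▸ Subgroup.mem_top g : g ∈ H ⊔ N)
    have hxy : ρ x (ρ y v) = _ := (hv.conj y).apply_eq_smul ⟨x, hx⟩
    have hzy : ρ z (ρ y v) = ρ (⟨z, hz⟩ * y : H) v := by
      rw [Subgroup.coe_mul, map_mul, Module.End.mul_apply]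
    rw [SetLike.mem_coe, Submodule.mem_comap, map_mul, Module.End.mul_apply, hxy, map_smul, hzy]
    exact Submodule.smul_mem _ _ (Submodule.subset_span ⟨_, rfl⟩)
  rw [← finrank_top, ← hspan, finrank_span_eq_card hlin, Nat.card_eq_fintype_card]

end IrreducibleRepresentations

section LinearCharacters

variable {G : Type*} [Group G]

theorem coe_circle_mem_irrCharacters (φ : G →* Circle) : (fun g ↦ (φ g : ℂ)) ∈ irrCharacters G := by
  let ρ : Representation ℂ G (Fin 1 → ℂ) :=
    (algebraMap ℂ (Module.End ℂ (Fin 1 → ℂ)) : ℂ →* _).comp (Circle.coeHom.comp φ)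
  refine ⟨1, ρ, isIrreducible_of_finrank_eq_one (Module.finrank_fin_fun ℂ) ρ, funext fun g ↦ ?_⟩
  change LinearMap.trace ℂ _ (algebraMap ℂ _ (φ g : ℂ)) = _
  simp [Algebra.algebraMap_eq_smul_one]

theorem isLinearChar_character_of_finrank_eq_one [Finite G] {V : Type*} [AddCommGroup V]
    [Module ℂ V] (hV : Module.finrank ℂ V = 1) (ρ : Representation ℂ G V) :
    IsLinearChar ρ.character := by
  obtain ⟨μ, hμ⟩ := exists_monoidHom_smul_of_finrank_eq_one hV ρ
  have hnorm (g : G) : μ g ∈ Submonoid.unitSphere ℂ := by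
    refine mem_sphere_zero_iff_norm.2 (Complex.norm_eq_one_of_pow_eq_one (n := orderOf g) ?_
      (orderOf_pos g).ne')
    rw [← map_pow, pow_orderOf_eq_one, map_one]
  refine ⟨μ.codRestrict (Submonoid.unitSphere ℂ) hnorm, fun g ↦ ?_⟩
  have := Module.finite_of_finrank_eq_succ hV
  change LinearMap.trace ℂ V (ρ g) = μ g
  simp [hμ, Algebra.algebraMap_eq_smul_one, hV]

theorem ncard_linear_irrCharacters_eq_index (G : Type*) [Group G] [Finite G] :
    {χ ∈ irrCharacters G | IsLinearChar χ}.ncard = (commutator G).index := by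
  let toChar (φ : G →* Circle) : G → ℂ := fun g ↦ φ g
  have toChar_injective : Function.Injective toChar := fun φ ψ h ↦
    MonoidHom.ext fun g ↦ Circle.ext (congrFun h g)
  have hrange : {χ ∈ irrCharacters G | IsLinearChar χ} = Set.range toChar := by
    ext χ
    constructor
    · rintro ⟨-, φ, hφ⟩
      exact ⟨φ, (funext hφ).symm⟩
    · rintro ⟨φ, rfl⟩
      exact ⟨coe_circle_mem_irrCharacters φ, φ, fun _ ↦ rfl⟩
  calc _ = Nat.card (G →* Circle) := by
        rw [hrange, ← Nat.card_coe_set_eq, Nat.card_range_of_injective toChar_injective]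
    _ = Nat.card (Abelianization G →* Circleˣ) := Nat.card_congr
        (Abelianization.lift.trans (toUnits.monoidHomCongrRight (M := Abelianization G)).toEquiv)
    _ = (commutator G).index :=
        CommGroup.card_monoidHom_of_hasEnoughRootsOfUnity (Abelianization G) Circle

end LinearCharacters

section ConjugacyClasses

variable {G : Type*} [Group G]

theorem carrier_mk_one : (ConjClasses.mk (1 : G)).carrier = {1} := by
  ext g
  rw [ConjClasses.mem_carrier_iff_mk_eq, ConjClasses.mk_eq_mk_iff_isConj, isConj_one_left,
    Set.mem_singleton_iff]

theorem ncard_carrier_mk (g : G) :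
    (ConjClasses.mk g).carrier.ncard = (Subgroup.centralizer {g}).index := by
  rw [← ConjAct.orbit_eq_carrier_conjClasses, ← MulAction.index_stabilizer,
    Subgroup.centralizer_eq_comap_stabilizer]
  exact ((MulAction.stabilizer (ConjAct G) g).index_comap_of_surjective
    (f := (ConjAct.toConjAct (G := G)).toMonoidHom) ConjAct.toConjAct.surjective).symm

theorem ncard_setOf_ncard_carrier_mk_eq [Finite G] (m : ℕ) :
    {g : G | (ConjClasses.mk g).carrier.ncard = m}.ncard =
      m * {C : ConjClasses G | C.carrier.ncard = m}.ncard := by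
  classical
  have := Fintype.ofFinite G
  have : Finite (ConjClasses G) := Quotient.finite _
  have := Fintype.ofFinite (ConjClasses G)
  rw [Set.ncard_eq_toFinset_card', Set.ncard_eq_toFinset_card',
    Finset.card_eq_sum_card_fiberwise (f := ConjClasses.mk)
      (t := {C : ConjClasses G | C.carrier.ncard = m}.toFinset) (by intro g hg; simpa using hg),
    mul_comm, ← smul_eq_mul]
  refine Finset.sum_eq_card_nsmul fun C hC ↦ ?_
  rw [Set.mem_toFinset, Set.mem_ofPred_eq] at hC
  refine Eq.trans ?_ ((Set.ncard_eq_toFinset_card' C.carrier).symm.trans hC)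
  congr 1
  ext g
  simp only [Finset.mem_filter, Set.mem_toFinset, Set.mem_ofPred_eq,
    ConjClasses.mem_carrier_iff_mk_eq]
  exact ⟨fun h ↦ h.2, fun h ↦ ⟨by rw [h, hC], h⟩⟩

end ConjugacyClasses

namespace frobeniusKernel

variable {G : Type*} [Group G] {H : Subgroup G} {g : G}

theorem mem_iff : g ∈ frobeniusKernel H ↔ ∀ a, a * g * a⁻¹ ∈ H → g = 1 := by
  rw [frobeniusKernel, Set.mem_union, Set.mem_compl_iff, Set.mem_iUnion, Set.mem_singleton_iff,
    ← imp_iff_not_or, forall_exists_index, (Equiv.inv G).forall_congr_left]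
  simp only [SetLike.mem_coe, Subgroup.mem_map_equiv, MulAut.conj_symm_apply, Equiv.inv_symm,
    Equiv.inv_apply, inv_inv]

theorem notMem_iff : g ∉ frobeniusKernel H ↔ g ≠ 1 ∧ ∃ a, a * g * a⁻¹ ∈ H := by
  rw [mem_iff, ← exists_imp, Classical.not_imp, and_comm]

theorem one_mem : (1 : G) ∈ frobeniusKernel H :=
  mem_iff.2 fun _ _ ↦ rfl

theorem conj_mem (hg : g ∈ frobeniusKernel H) (a : G) : a * g * a⁻¹ ∈ frobeniusKernel H :=
  mem_iff.2 fun b hb ↦ conj_eq_one_iff.2 (mem_iff.1 hg (b * a) (by simpa [mul_assoc] using hb))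

theorem eq_one_of_mem (hg : g ∈ frobeniusKernel H) (hgH : g ∈ H) : g = 1 :=
  mem_iff.1 hg 1 (by simpa using hgH)

theorem normal_of_coe_eq {N : Subgroup G} (hN : (N : Set G) = frobeniusKernel H) : N.Normal where
  conj_mem x hx g := by
    rw [← SetLike.mem_coe, hN] at hx ⊢
    exact conj_mem hx g

end frobeniusKernel

theorem eq_one_of_comp_eq_of_fixedPointFree {N M : Type*} [Group N] [Finite N] [Monoid M]
    {φ : N →* N} (hφ : MonoidHom.FixedPointFree φ) {μ : N →* M} (hμ : μ.comp φ = μ) : μ = 1 := by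
  ext x
  obtain ⟨z, rfl⟩ := hφ.commutatorMap_surjective x
  calc μ (z / φ z) = μ (φ z) * μ (φ z)⁻¹ := by
        rw [div_eq_mul_inv, map_mul, ← MonoidHom.comp_apply μ φ z, hμ]
    _ = 1 := by rw [← map_mul, mul_inv_cancel, map_one]

namespace IsFrobeniusComplement

variable {G : Type*} [Group G] {H : Subgroup G} (hH : IsFrobeniusComplement H)
include hH

section Malnormality

theorem mem_of_conj_mem {g x : G} (hx : x ∈ H) (hx1 : x ≠ 1) (hg : g * x * g⁻¹ ∈ H) : g ∈ H := by
  by_contra hgH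
  have hmem : g * x * g⁻¹ ∈ H ⊓ H.map (MulAut.conj g).toMonoidHom := ⟨hg, x, hx, rfl⟩
  rw [hH.malnormal g hgH, Subgroup.mem_bot, conj_eq_one_iff] at hmem
  exact hx1 hmem

theorem mem_of_commute {g x : G} (hx : x ∈ H) (hx1 : x ≠ 1) (hgx : Commute g x) : g ∈ H :=
  hH.mem_of_conj_mem hx hx1 (by rwa [hgx.eq, mul_inv_cancel_right])

theorem center_eq_bot : Subgroup.center G = ⊥ := by
  rw [Subgroup.eq_bot_iff_forall]
  intro z hz
  rw [Subgroup.mem_center_iff] at hz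
  obtain ⟨x, hx, hx1⟩ := H.bot_or_exists_ne_one.resolve_left hH.nontrivial
  have hzH : z ∈ H := hH.mem_of_commute hx hx1 (hz x).symm
  by_contra hz1
  exact hH.proper ((Subgroup.eq_top_iff' H).2 fun g ↦ hH.mem_of_commute hzH hz1 (hz g))

theorem eq_one_of_commute {x y : G} (hx : x ∈ frobeniusKernel H) (hy : y ∈ H) (hy1 : y ≠ 1)
    (hxy : Commute x y) : x = 1 :=
  frobeniusKernel.eq_one_of_mem hx (hH.mem_of_commute hy hy1 hxy)

theorem centralizer_eq_of_mem [IsMulCommutative H] {y : G} (hy : y ∈ H) (hy1 : y ≠ 1) :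
    Subgroup.centralizer {y} = H := by
  ext g
  rw [Subgroup.mem_centralizer_singleton_iff]
  exact ⟨hH.mem_of_commute hy hy1, fun hg ↦ setLike_mul_comm hg hy⟩

theorem coe_centralizer_of_mem_frobeniusKernel
    (hK : ∀ x ∈ frobeniusKernel H, ∀ y ∈ frobeniusKernel H, Commute x y) {x : G}
    (hx : x ∈ frobeniusKernel H) (hx1 : x ≠ 1) :
    (Subgroup.centralizer {x} : Set G) = frobeniusKernel H := by
  ext g
  rw [SetLike.mem_coe, Subgroup.mem_centralizer_singleton_iff]
  refine ⟨fun hgx ↦ ?_, fun hg ↦ hK g hg x hx⟩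
  by_contra hg
  obtain ⟨hg1, a, ha⟩ := frobeniusKernel.notMem_iff.1 hg
  have hcomm : Commute (a * x * a⁻¹) (a * g * a⁻¹) := Commute.conj_iff a |>.2 (Commute.symm hgx)
  exact hx1 (conj_eq_one_iff.1 (hH.eq_one_of_commute (frobeniusKernel.conj_mem hx a) ha
    (mt conj_eq_one_iff.1 hg1) hcomm))

theorem fixedPointFree_conjNormal {N : Subgroup G} [N.Normal]
    (hN : (N : Set G) = frobeniusKernel H) {y : G} (hy : y ∈ H) (hy1 : y ≠ 1) :
    MonoidHom.FixedPointFree (MulAut.conjNormal y : N ≃* N) := by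
  intro x hx
  have hxy : y * x * y⁻¹ = x := congrArg Subtype.val hx
  exact Subtype.ext (hH.eq_one_of_commute (hN ▸ x.2) hy hy1 (mul_inv_eq_iff_eq_mul.1 hxy).symm)

end Malnormality

variable [Finite G]

theorem ncard_compl_frobeniusKernel :
    (frobeniusKernel H)ᶜ.ncard = H.index * (Nat.card H - 1) := by
  let f (p : (G ⧸ H) × ({1}ᶜ : Set H)) : G := p.1.out * p.2 * p.1.out⁻¹
  have f_injective : Function.Injective f := by
    rintro ⟨q, x, hx⟩ ⟨p, y, hy⟩ h
    have hconj : (p.out⁻¹ * q.out) * x * (p.out⁻¹ * q.out)⁻¹ = (y : G) := by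
      calc _ = p.out⁻¹ * (q.out * x * q.out⁻¹) * p.out := by group
        _ = p.out⁻¹ * (p.out * y * p.out⁻¹) * p.out := congrArg (p.out⁻¹ * · * p.out) h
        _ = y := by group
    obtain rfl : p = q := by
      rw [← QuotientGroup.out_eq' p, ← QuotientGroup.out_eq' q]
      exact QuotientGroup.eq.2 (hH.mem_of_conj_mem x.2 (by simpa using hx) (hconj ▸ y.2))
    obtain rfl : x = y := by simpa using hconj
    rfl
  have range_f : Set.range f = (frobeniusKernel H)ᶜ := by
    ext g
    rw [Set.mem_compl_iff, frobeniusKernel.notMem_iff]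
    constructor
    · rintro ⟨⟨q, x, hx⟩, rfl⟩
      exact ⟨by simpa [f] using hx, q.out⁻¹, by simp [f, mul_assoc]⟩
    · rintro ⟨hg1, a, ha⟩
      obtain ⟨z, hz⟩ := QuotientGroup.mk_out_eq_mul H a⁻¹
      refine ⟨⟨(a⁻¹ : G), z⁻¹ * ⟨_, ha⟩ * z⁻¹⁻¹, ?_⟩, ?_⟩
      · rw [Set.mem_compl_singleton_iff, Ne, conj_eq_one_iff, Subtype.ext_iff]
        exact mt conj_eq_one_iff.1 hg1
      · simp [f, hz, mul_assoc]
  rw [← range_f, ← Nat.card_coe_set_eq, Nat.card_range_of_injective f_injective, Nat.card_prod,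
    Subgroup.index, Nat.card_coe_set_eq, Set.ncard_compl, Set.ncard_singleton]

theorem one_lt_card : 1 < Nat.card H :=
  (Subgroup.one_lt_card_iff_ne_bot H).2 hH.nontrivial

theorem ncard_frobeniusKernel : (frobeniusKernel H).ncard = H.index := by
  have hsum := Set.ncard_add_ncard_compl (frobeniusKernel H)
  obtain ⟨m, hm⟩ := Nat.exists_eq_add_of_lt hH.one_lt_card
  rw [hH.ncard_compl_frobeniusKernel, ← H.index_mul_card, hm, Nat.add_sub_cancel, mul_add _ _ 1,
    mul_one] at hsum
  omega

theorem exists_mem_frobeniusKernel_ne_one : ∃ x ∈ frobeniusKernel H, x ≠ 1 := by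
  refine Set.exists_ne_of_one_lt_ncard ?_ 1
  rw [hH.ncard_frobeniusKernel]
  exact Subgroup.one_lt_index_of_ne_top hH.proper

theorem card_lt_ncard_frobeniusKernel : Nat.card H < (frobeniusKernel H).ncard := by
  obtain ⟨x, hx, hx1⟩ := hH.exists_mem_frobeniusKernel_ne_one
  let f (y : H) : G := y * x * (y : G)⁻¹
  have f_injective : Function.Injective f := by
    intro y z (h : y * x * (y : G)⁻¹ = z * x * (z : G)⁻¹)
    have hcomm : Commute x ((z : G)⁻¹ * y) := by
      calc x * ((z : G)⁻¹ * y) = (z : G)⁻¹ * (z * x * (z : G)⁻¹) * y := by group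
        _ = (z : G)⁻¹ * y * x := by rw [← h]; group
    by_contra hyz
    refine hx1 (hH.eq_one_of_commute hx (z⁻¹ * y).2 ?_ hcomm)
    rwa [Subgroup.coe_mul, Subgroup.coe_inv, Ne, inv_mul_eq_one, Subtype.coe_inj, eq_comm]
  have range_f_subset : Set.range f ⊂ frobeniusKernel H := by
    refine ⟨Set.range_subset_iff.2 fun y ↦ frobeniusKernel.conj_mem hx _, fun h ↦ ?_⟩
    obtain ⟨y, hy⟩ := h frobeniusKernel.one_mem
    exact hx1 (conj_eq_one_iff.1 hy)
  rw [← Nat.card_range_of_injective f_injective, Nat.card_coe_set_eq]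
  exact Set.ncard_lt_ncard range_f_subset

theorem exists_isMulCommutative_coe_eq
    (hK : ∀ x ∈ frobeniusKernel H, ∀ y ∈ frobeniusKernel H, Commute x y) :
    ∃ N : Subgroup G, (N : Set G) = frobeniusKernel H ∧ IsMulCommutative N := by
  obtain ⟨x, hx, hx1⟩ := hH.exists_mem_frobeniusKernel_ne_one
  have hN := hH.coe_centralizer_of_mem_frobeniusKernel hK hx hx1
  exact ⟨_, hN, ⟨⟨fun y z ↦ Subtype.ext (hK y (hN ▸ y.2) z (hN ▸ z.2))⟩⟩⟩

section NormalComplement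

variable {N : Subgroup G} (hN : (N : Set G) = frobeniusKernel H)
include hN

theorem isComplement' : N.IsComplement' H := by
  refine Subgroup.isComplement'_of_card_mul_and_disjoint ?_ (Subgroup.disjoint_def.2 ?_)
  · rw [← SetLike.coe_sort_coe N, hN, Nat.card_coe_set_eq, hH.ncard_frobeniusKernel,
      H.index_mul_card]
  · exact fun {x} hxN hx ↦ frobeniusKernel.eq_one_of_mem (hN ▸ hxN) hx

open scoped commutatorElement in
theorem commutator_eq [IsMulCommutative H] : commutator G = N := by
  have := frobeniusKernel.normal_of_coe_eq hN
  refine le_antisymm (Subgroup.Normal.commutator_le_of_self_sup_commutative_eq_top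
    (hH.isComplement' hN).sup_eq_top inferInstance) fun x hx ↦ ?_
  obtain ⟨y, hy, hy1⟩ := H.bot_or_exists_ne_one.resolve_left hH.nontrivial
  obtain ⟨z, hz⟩ := (hH.fixedPointFree_conjNormal hN hy hy1).commutatorMap_surjective ⟨x, hx⟩
  have hx_eq : x = ⁅(z : G), y⁆ := by
    rw [← show ((_ : N) : G) = x from congrArg Subtype.val hz, commutatorElement_def]
    simp [MonoidHom.commutatorMap, div_eq_mul_inv, mul_assoc]
  exact hx_eq ▸ Subgroup.commutator_mem_commutator (Subgroup.mem_top _) (Subgroup.mem_top y)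

theorem ncard_linear_irrCharacters [IsMulCommutative H] :
    {χ ∈ irrCharacters G | IsLinearChar χ}.ncard = Nat.card H := by
  rw [ncard_linear_irrCharacters_eq_index, hH.commutator_eq hN,
    (hH.isComplement' hN).symm.index_eq_card]

theorem injective_conj_weight [N.Normal] {M : Type*} [Monoid M] {μ : N →* M} (hμ : μ ≠ 1) :
    Function.Injective fun y : H ↦
      μ.comp (MulAut.conjNormal (y : G)⁻¹ : N ≃* N).toMonoidHom := by
  intro y z (hyz : μ.comp _ = μ.comp _)
  by_contra hne
  refine hμ (eq_one_of_comp_eq_of_fixedPointFree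
    (φ := (MulAut.conjNormal (z⁻¹ * y : G) : N ≃* N).toMonoidHom) (hH.fixedPointFree_conjNormal hN
      (H.mul_mem (H.inv_mem z.2) y.2) fun h ↦ hne (Subtype.ext (inv_mul_eq_one.1 h).symm)) ?_)
  ext x
  simpa using (DFunLike.congr_fun hyz (MulAut.conjNormal (y : G) x)).symm

theorem finrank_eq_one_or_eq_card [IsMulCommutative H] [IsMulCommutative N] {k V : Type*} [Field k]
    [IsAlgClosed k] [AddCommGroup V] [Module k V] [FiniteDimensional k V]
    (ρ : Representation k G V) [ρ.IsIrreducible] :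
    Module.finrank k V = 1 ∨ Module.finrank k V = Nat.card H := by
  have := frobeniusKernel.normal_of_coe_eq hN
  have := nontrivial_of_isIrreducible ρ
  obtain ⟨μ, v, hv⟩ := exists_isWeightVector (ρ.comp N.subtype) fun x y ↦
    Commute.map (IsMulCommutative.is_comm.comm x y) (ρ.comp N.subtype)
  obtain rfl | hμ := eq_or_ne μ 1
  · have hker : commutator G ≤ ρ.ker := hH.commutator_eq hN ▸ le_ker_of_isWeightVector_one ρ hv
    exact .inl (finrank_eq_one_of_commutator_le_ker ρ hker)
  · have hHN : H ⊔ N = ⊤ := (hH.isComplement' hN).symm.sup_eq_top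
    exact .inr (finrank_eq_card_of_injective_conj_weight hHN ρ hv (hH.injective_conj_weight hN hμ))

theorem apply_one_of_not_isLinearChar [IsMulCommutative H] [IsMulCommutative N] {χ : G → ℂ}
    (hχ : χ ∈ irrCharacters G) (hχ_lin : ¬ IsLinearChar χ) : χ 1 = Nat.card H := by
  obtain ⟨n, ρ, hρ, rfl⟩ := hχ
  rw [ρ.char_one]
  exact congrArg _ ((hH.finrank_eq_one_or_eq_card hN ρ).resolve_left fun h ↦
    hχ_lin (isLinearChar_character_of_finrank_eq_one h ρ))

end NormalComplement

section ConjugacyClasses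

theorem ncard_carrier_mk_of_notMem [IsMulCommutative H] {g : G} (hg : g ∉ frobeniusKernel H) :
    (ConjClasses.mk g).carrier.ncard = (frobeniusKernel H).ncard := by
  obtain ⟨hg1, a, ha⟩ := frobeniusKernel.notMem_iff.1 hg
  have hmk : ConjClasses.mk g = ConjClasses.mk (a * g * a⁻¹) :=
    ConjClasses.mk_eq_mk_iff_isConj.2 (isConj_iff.2 ⟨a, rfl⟩)
  rw [hmk, ncard_carrier_mk, hH.centralizer_eq_of_mem ha (mt conj_eq_one_iff.1 hg1),
    hH.ncard_frobeniusKernel]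

variable (hK : ∀ x ∈ frobeniusKernel H, ∀ y ∈ frobeniusKernel H, Commute x y)
include hK

theorem ncard_carrier_mk_of_mem {g : G} (hg : g ∈ frobeniusKernel H) (hg1 : g ≠ 1) :
    (ConjClasses.mk g).carrier.ncard = Nat.card H := by
  rw [ncard_carrier_mk]
  exact (hH.isComplement'
    (hH.coe_centralizer_of_mem_frobeniusKernel hK hg hg1)).symm.index_eq_card

variable [IsMulCommutative H]

theorem carrier_eq_or_ncard_carrier_eq (C : ConjClasses G) :
    C.carrier = {1} ∨ C.carrier.ncard = Nat.card H ∨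
      C.carrier.ncard = (frobeniusKernel H).ncard := by
  obtain ⟨g, rfl⟩ := C.exists_rep
  by_cases hg : g ∈ frobeniusKernel H
  · obtain rfl | hg1 := eq_or_ne g 1
    · exact .inl carrier_mk_one
    · exact .inr (.inl (hH.ncard_carrier_mk_of_mem hK hg hg1))
  · exact .inr (.inr (hH.ncard_carrier_mk_of_notMem hg))

theorem setOf_ncard_carrier_mk_eq_card :
    {g : G | (ConjClasses.mk g).carrier.ncard = Nat.card H} = frobeniusKernel H \ {1} := by
  have := hH.one_lt_card
  have := hH.card_lt_ncard_frobeniusKernel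
  ext g
  rw [Set.mem_ofPred_eq, Set.mem_sdiff, Set.mem_singleton_iff]
  by_cases hg : g ∈ frobeniusKernel H
  · obtain rfl | hg1 := eq_or_ne g 1
    · simp only [carrier_mk_one, Set.ncard_singleton, not_true_eq_false, and_false, iff_false]
      omega
    · simp [hH.ncard_carrier_mk_of_mem hK hg hg1, hg, hg1]
  · simp only [hH.ncard_carrier_mk_of_notMem hg, hg, false_and, iff_false]
    omega

theorem setOf_ncard_carrier_mk_eq_ncard_frobeniusKernel :
    {g : G | (ConjClasses.mk g).carrier.ncard = (frobeniusKernel H).ncard} =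
      (frobeniusKernel H)ᶜ := by
  have := hH.one_lt_card
  have := hH.card_lt_ncard_frobeniusKernel
  ext g
  rw [Set.mem_ofPred_eq, Set.mem_compl_iff]
  by_cases hg : g ∈ frobeniusKernel H
  · obtain rfl | hg1 := eq_or_ne g 1
    · simp only [carrier_mk_one, Set.ncard_singleton, hg, not_true_eq_false, iff_false]
      omega
    · simp only [hH.ncard_carrier_mk_of_mem hK hg hg1, hg, not_true_eq_false, iff_false]
      omega
  · simp [hH.ncard_carrier_mk_of_notMem hg, hg]

theorem card_mul_ncard_setOf_ncard_carrier_eq_card :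
    Nat.card H * {C : ConjClasses G | C.carrier.ncard = Nat.card H}.ncard =
      (frobeniusKernel H).ncard - 1 := by
  rw [← ncard_setOf_ncard_carrier_mk_eq, hH.setOf_ncard_carrier_mk_eq_card hK,
    Set.ncard_sdiff_singleton_of_mem frobeniusKernel.one_mem]

theorem ncard_setOf_ncard_carrier_eq_ncard_frobeniusKernel :
    {C : ConjClasses G | C.carrier.ncard = (frobeniusKernel H).ncard}.ncard = Nat.card H - 1 := by
  have hpos : 0 < (frobeniusKernel H).ncard := hH.card_lt_ncard_frobeniusKernel.pos
  refine Nat.eq_of_mul_eq_mul_left hpos ?_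
  rw [← ncard_setOf_ncard_carrier_mk_eq, hH.setOf_ncard_carrier_mk_eq_ncard_frobeniusKernel hK,
    hH.ncard_compl_frobeniusKernel, hH.ncard_frobeniusKernel]

end ConjugacyClasses

end IsFrobeniusComplement

theorem proposition3p2 {G : Type*} [Group G] [Finite G] (H : Subgroup G)
    (hH : IsFrobeniusComplement H) (h k : ℕ)
    (hHcomm : ∀ x ∈ H, ∀ y ∈ H, x * y = y * x)
    (hKcomm : ∀ x ∈ frobeniusKernel H, ∀ y ∈ frobeniusKernel H, x * y = y * x)
    (hh : Nat.card H = h) (hk : (frobeniusKernel H).ncard = k) :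
    h ∣ k - 1 ∧
    Subgroup.center G = ⊥ ∧
    {C : ConjClasses G | C.carrier.ncard = h}.ncard = (k - 1) / h ∧
    {C : ConjClasses G | C.carrier.ncard = k}.ncard = h - 1 ∧
    (∀ C : ConjClasses G, C.carrier = {1} ∨ C.carrier.ncard = h ∨ C.carrier.ncard = k) ∧
    {χ ∈ irrCharacters G | IsLinearChar χ}.ncard = h ∧
    (∀ χ ∈ irrCharacters G, ¬ IsLinearChar χ → χ 1 = (h : ℂ)) := by
  subst hh hk
  have : IsMulCommutative H := ⟨⟨fun x y ↦ Subtype.ext (hHcomm x x.2 y y.2)⟩⟩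
  obtain ⟨N, hN, _⟩ := hH.exists_isMulCommutative_coe_eq hKcomm
  have hcount := hH.card_mul_ncard_setOf_ncard_carrier_eq_card hKcomm
  exact ⟨Dvd.intro _ hcount, hH.center_eq_bot,
    Nat.eq_div_of_mul_eq_right Nat.card_pos.ne' hcount,
    hH.ncard_setOf_ncard_carrier_eq_ncard_frobeniusKernel hKcomm,
    hH.carrier_eq_or_ncard_carrier_eq hKcomm,
    hH.ncard_linear_irrCharacters hN,
    fun χ ↦ hH.apply_one_of_not_isLinearChar hN⟩
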